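/- For $\tau$ in the upper half-plane, $z\in\mathbb C$ and $a,b\in\mathbb R$ let $$\theta\big[{}^{a}_{b}\big](z,\tau)=\sum_{n\in\mathbb Z}\exp\big(\pi i(n+a)^2\tau+2\pi i(n+a)(z+b)\big),$$ and write $\theta[{}^{a}_{b}]=\theta[{}^{a}_{b}](0,\tau)$ and $\theta'[{}^{a}_{b}]=\frac{\partial}{\partial z}\theta[{}^{a}_{b}](z,\tau)\big|_{z=0}$. For $x\in\mathbb Q$ and $k\ge 0$ let $\mathfrak T^kx=3^kx-\lfloor 3^kx\rfloor$ be the $k$-th power of multiplication by $3$ modulo $1$; thus $\mathfrak T^k(m/p)=((3^km)\bmod p)/p$. Let $\varepsilon',\varepsilon\in\mathbb Q$. If the denominators of $\varepsilon'$ and $\varepsilon$ (in lowest terms) are not divisible by $3$, then multiplication by $3$ acts periodically on $[{}^{\varepsilon'}_{\varepsilon}]$: there is $\mathfrak t\ge 1$ with $\mathfrak T^{k+\mathfrak t}\varepsilon'=\mathfrak T^{k}\varepsilon'$ and $\mathfrak T^{k+\mathfrak t}\varepsilon=\mathfrak T^{k}\varepsilon$ for all $k\ge 0$. Let $\mathfrak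 t\ge1$ be any such period of $[{}^{\varepsilon'}_{\varepsilon}]$, with no assumption on the denominators, and suppose that $(\varepsilon',\varepsilon)\not\equiv(\tfrac12,\tfrac12)$ modulo $\mathbb Z^2$. Then, for every $\tau$ in the upper half-plane, $\theta\big[{}^{\mathfrak T^k\varepsilon'}_{\mathfrak T^k\varepsilon}\big]\ne0$ for all $k\ge0$, and for every $0\le k\le\mathfrak t-1$ $$\theta'\big[{}^{\mathfrak T^{k}\varepsilon'}_{\mathfrak T^{k}\varepsilon}\big] =\Big((3^{\mathfrak t}-1)\prod_{i=0}^{\mathfrak t-1}\theta\big[{}^{\mathfrak T^{i}\varepsilon'}_{\mathfrak T^{i}\varepsilon}\big]\Big)^{-1} \theta'\big[{}^{1/2}_{1/2}\big]\,\theta\big[{}^{\mathfrak T^{k}\varepsilon'}_{\mathfrak T^{k}\varepsilon}\big] \sum_{j=k}^{\mathfrak t-1+k}3^{\mathfrak t-1+k-j}\,E_j\; \theta\big[{}^{\frac12-2\cdot3^{j}\varepsilon'}_{\frac12-2\cdot3^{j}\varepsilon}\big]^{3}\, \theta\big[{}^{\mathfrak T^{j}\varepsilon'}_{\mathfrak T^{j}\varepsilon}\big]^{-2}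 \prod_{\substack{k\le l\le\mathfrak t-1+k\\ l\not\equiv j,\,j+1\ (\mathrm{mod}\ \mathfrak t)}} \theta\big[{}^{\mathfrak T^{l}\varepsilon'}_{\mathfrak T^{l}\varepsilon}\big],$$ where $$E_j=\exp\Big(6\pi i\,(1-\lfloor3^{j}\varepsilon\rfloor)\,\mathfrak T^{j}\varepsilon'-2\pi i\,\lfloor3^{j+1}\varepsilon\rfloor\,\mathfrak T^{j+1}\varepsilon'\Big).$$ -/

import Mathlib

/-- The theta function with real characteristic `[a; b]` (upper entry `a`, lower entry `b`). -/
noncomputable def thetaChar (a b : ℝ) (z : ℂ) (τ : UpperHalfPlane) : ℂ :=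
  ∑' n : ℤ, Complex.exp
    (Real.pi * Complex.I * ((n : ℂ) + a) ^ 2 * (τ : ℂ)
      + 2 * Real.pi * Complex.I * ((n : ℂ) + a) * (z + b))

/-- The second expression for `thetaChar`, through Mathlib's two-variable theta function. -/
theorem thetaChar_eq (a b : ℝ) (z : ℂ) (τ : UpperHalfPlane) :
    thetaChar a b z τ =
      Complex.exp (Real.pi * Complex.I * (a : ℂ) ^ 2 * (τ : ℂ)
        + 2 * Real.pi * Complex.I * a * (z + b)) * jacobiTheta₂ (z + τ * a + b) τ := by
  rw [thetaChar, jacobiTheta₂, ← tsum_mul_left]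
  refine tsum_congr fun n => ?_
  rw [jacobiTheta₂_term, ← Complex.exp_add]
  congr 1
  ring

/-- `thetaChar` is differentiable in `z`, so that `thetaDeriv` below is a genuine derivative. -/
theorem differentiable_thetaChar (a b : ℝ) (τ : UpperHalfPlane) :
    Differentiable ℂ (fun z => thetaChar a b z τ) := by
  intro z
  simp only [thetaChar_eq]
  refine DifferentiableAt.mul (by fun_prop) ?_
  exact (differentiableAt_jacobiTheta₂_fst (z + τ * a + b) τ.im_pos).comp z
    (f := fun z : ℂ => z + τ * a + b) (by fun_prop)

/-- The theta constant `θ[a; b](0, τ)`. -/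
noncomputable def thetaConst (a b : ℝ) (τ : UpperHalfPlane) : ℂ :=
  thetaChar a b 0 τ

/-- The theta derivative `θ'[a; b](0, τ) = ∂/∂z θ[a; b](z, τ)` at `z = 0`. -/
noncomputable def thetaDeriv (a b : ℝ) (τ : UpperHalfPlane) : ℂ :=
  deriv (fun z => thetaChar a b z τ) 0

/-- `mulThree k x` is the `k`-th power of multiplication by `3` modulo `1`,
`𝔗ᵏ x = 3ᵏ x - ⌊3ᵏ x⌋`; on fractions it is `((3ᵏ m) mod p) / p`, see `mulThree_div`. -/
def mulThree (k : ℕ) (x : ℚ) : ℚ := Int.fract (3 ^ k * x)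

theorem mulThree_div (k : ℕ) (m : ℤ) (p : ℕ) :
    mulThree k ((m : ℚ) / p) = (((3 ^ k * m) % (p : ℤ) : ℤ) : ℚ) / p := by
  have h : (3 ^ k * ((m : ℚ) / p)) = ((3 ^ k * m : ℤ) : ℚ) / (p : ℚ) := by
    push_cast
    ring
  rw [mulThree, h]
  exact Int.fract_div_intCast_eq_div_intCast_mod

theorem mulThree_succ (k : ℕ) (x : ℚ) : mulThree (k + 1) x = mulThree 1 (mulThree k x) := by
  simp only [mulThree, pow_one]
  rw [Int.fract_eq_fract]
  refine ⟨3 * ⌊(3 : ℚ) ^ k * x⌋, ?_⟩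
  rw [Int.fract]
  push_cast
  ring

/-- Multiplication by `3` modulo `1` acts periodically on the characteristic `[a; b]`,
and `t` is a (not necessarily minimal) period. -/
def IsThreePeriod (t : ℕ) (a b : ℚ) : Prop :=
  0 < t ∧ ∀ k : ℕ, mulThree (k + t) a = mulThree k a ∧ mulThree (k + t) b = mulThree k b

/-!
Every theta constant with characteristics is, up to an exponential factor, a value of the odd theta
function `θ₁ = θ[1/2; 1/2]` (`oddTheta`), and the claim follows from two facts about `θ₁`, both
consequences of Weierstrass's three-term relation (`oddTheta_three_term`). That relation is the
Plücker relation for the `2 × 2` minors `θ₁(x + y) θ₁(x - y) = A(x) B(y) - B(x) A(y)`, where `A`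
and `B` are theta functions of modulus `2τ` (`oddTheta_add_mul_sub`).

* The zeros of `θ₁` are lattice points. If `θ₁(x) = 0`, the three-term relation says that the
  quotient `G(p) = θ₁(p + x) / θ₁(p)` has the property that `G(p) G(q)` depends only on `p + q`.
  Hence `G` is a constant times an exponential, and comparing the quasi-periods of `θ₁(p + x)` and
  `θ₁(p)` puts `x` into `ℤτ + ℤ` (`exists_int_eq_of_oddTheta_eq_zero`). So a theta constant
  vanishes only at the characteristics congruent to `[1/2; 1/2]`, which a periodic
  orbit of multiplication by `3` meets
  only if it starts there.

* Differentiating a degenerate case of the three-term relation gives the triplication formula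
  `3 θ₁'(u)/θ₁(u) - θ₁'(3u)/θ₁(3u) = θ₁'(0) θ₁(2u)³ / (θ₁(u)³ θ₁(3u))`
  (`deriv_oddTheta_zero_mul`).

For characteristics, the triplication formula is a recursion `3 Lⱼ - Lⱼ₊₁ = Dⱼ` for the
logarithmic derivatives `Lⱼ = θ'/θ` along the orbit (`thetaDeriv_mulThree_step`); the exponentials
`Eⱼ` come from reducing characteristics modulo integers. Over a period `t` the recursion telescopes
to `(3ᵗ - 1) Lₖ = ∑ⱼ 3^(t - 1 + k - j) Dⱼ`, which is the formula
(`eq_sum_of_periodic_recursion`).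
-/

/-! ### Characteristics: translation, integer shifts, parity -/

/-- A real shift of the characteristic is a translation of the argument, up to a factor. -/
theorem thetaChar_add (a b c d : ℝ) (z : ℂ) (τ : UpperHalfPlane) :
    thetaChar (a + c) (b + d) z τ =
      Complex.exp (Real.pi * Complex.I * (a : ℂ) ^ 2 * (τ : ℂ)
        + 2 * Real.pi * Complex.I * a * (z + b + d)) * thetaChar c d (z + τ * a + b) τ := by
  rw [thetaChar, thetaChar, ← tsum_mul_left]
  refine tsum_congr fun n => ?_
  rw [← Complex.exp_add]
  congr 1
  push_cast
  ring

theorem thetaChar_add_int (a b : ℝ) (M N : ℤ) (z : ℂ) (τ : UpperHalfPlane) :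
    thetaChar (a + M) (b + N) z τ =
      Complex.exp (2 * Real.pi * Complex.I * a * N) * thetaChar a b z τ := by
  rw [thetaChar, thetaChar, ← tsum_mul_left, ← (Equiv.subRight M).tsum_eq]
  refine tsum_congr fun n => ?_
  rw [← Complex.exp_add, Complex.exp_eq_exp_iff_exists_int]
  refine ⟨n * N, ?_⟩
  simp only [Equiv.subRight_apply]
  push_cast
  ring

theorem thetaChar_neg (a b : ℝ) (z : ℂ) (τ : UpperHalfPlane) :
    thetaChar (-a) (-b) (-z) τ = thetaChar a b z τ := by
  rw [thetaChar, thetaChar, ← (Equiv.neg ℤ).tsum_eq]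
  refine tsum_congr fun n => ?_
  congr 1
  simp only [Equiv.neg_apply]
  push_cast
  ring

/-- The odd theta function `θ[1/2; 1/2](z, τ)`, all of whose translates by real characteristics
are the functions `thetaChar`. -/
noncomputable def oddTheta (τ : UpperHalfPlane) (z : ℂ) : ℂ :=
  thetaChar (1 / 2) (1 / 2) z τ

theorem differentiable_oddTheta (τ : UpperHalfPlane) : Differentiable ℂ (oddTheta τ) :=
  differentiable_thetaChar _ _ τ

theorem oddTheta_neg (τ : UpperHalfPlane) (z : ℂ) : oddTheta τ (-z) = -oddTheta τ z := by
  have h := thetaChar_add_int (-(1 / 2)) (-(1 / 2)) 1 1 (-z) τ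
  rw [thetaChar_neg] at h
  have e : (2 * Real.pi * Complex.I * ((-(1 / 2) : ℝ) : ℂ) * ((1 : ℤ) : ℂ))
      = -(Real.pi * Complex.I) := by
    push_cast
    ring
  rw [e, Complex.exp_neg, Complex.exp_pi_mul_I] at h
  norm_num at h
  simpa [oddTheta] using h

theorem oddTheta_zero (τ : UpperHalfPlane) : oddTheta τ 0 = 0 := by
  have h := oddTheta_neg τ 0
  rw [neg_zero] at h
  exact self_eq_neg.mp h

theorem deriv_oddTheta_neg (τ : UpperHalfPlane) (z : ℂ) :
    deriv (oddTheta τ) (-z) = deriv (oddTheta τ) z := by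
  have h := deriv_comp_neg (oddTheta τ) z
  have h2 : (fun x => oddTheta τ (-x)) = fun x => -oddTheta τ x :=
    funext fun x => oddTheta_neg τ x
  rw [h2, deriv.fun_neg] at h
  exact (neg_injective h).symm

theorem oddTheta_add_one (τ : UpperHalfPlane) (z : ℂ) :
    oddTheta τ (z + 1) = -oddTheta τ z := by
  have h := thetaChar_add_int (1 / 2) (1 / 2) 0 1 z τ
  have h2 := thetaChar_add 0 1 (1 / 2) (1 / 2) z τ
  have e : (2 * Real.pi * Complex.I * ((1 / 2 : ℝ) : ℂ) * ((1 : ℤ) : ℂ))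
      = Real.pi * Complex.I := by
    push_cast
    ring
  rw [e, Complex.exp_pi_mul_I] at h
  rw [add_comm (0 : ℝ), add_comm (1 : ℝ)] at h2
  simp only [Int.cast_zero, Int.cast_one, Complex.ofReal_zero, Complex.ofReal_one] at h h2
  rw [h] at h2
  simpa [oddTheta] using h2.symm

theorem oddTheta_add_tau (τ : UpperHalfPlane) (z : ℂ) :
    oddTheta τ (z + τ) =
      -(Complex.exp (-(Real.pi * Complex.I * τ + 2 * Real.pi * Complex.I * z))
        * oddTheta τ z) := by
  have h := thetaChar_add_int (1 / 2) (1 / 2) 1 0 z τ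
  have h2 := thetaChar_add 1 0 (1 / 2) (1 / 2) z τ
  rw [add_comm (1 : ℝ), add_comm (0 : ℝ)] at h2
  simp only [Int.cast_zero, Int.cast_one, Complex.ofReal_zero, Complex.ofReal_one, mul_zero,
    Complex.exp_zero, one_mul, mul_one, add_zero, one_pow] at h h2
  rw [h] at h2
  have e : (Real.pi * Complex.I * τ + 2 * Real.pi * Complex.I * (z + ((1 / 2 : ℝ) : ℂ)))
      = (Real.pi * Complex.I * τ + 2 * Real.pi * Complex.I * z) + Real.pi * Complex.I := by
    push_cast
    ring
  rw [e, Complex.exp_add, Complex.exp_pi_mul_I] at h2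
  rw [Complex.exp_neg]
  unfold oddTheta
  rw [h2]
  field_simp

/-- `jacobiTheta₂ (·, τ)` is not identically zero: its mean over a period is `1`. -/
theorem exists_jacobiTheta₂_ne_zero (τ : UpperHalfPlane) : ∃ z : ℂ, jacobiTheta₂ z τ ≠ 0 := by
  by_contra! h0
  have hsum : HasSum (fun n : ℤ => ∫ x : ℝ in (0 : ℝ)..1, jacobiTheta₂_term n x τ)
      (∫ x : ℝ in (0 : ℝ)..1, ∑' n : ℤ, jacobiTheta₂_term n x τ) := by
    simp only [intervalIntegral.integral_of_le zero_le_one]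
    refine MeasureTheory.hasSum_integral_of_summable_integral_norm (fun n => ?_) ?_
    · have hc : Continuous fun x : ℝ => jacobiTheta₂_term n x τ := by
        unfold jacobiTheta₂_term
        fun_prop
      exact (hc.integrableOn_Icc (a := 0) (b := 1)).mono_set Set.Ioc_subset_Icc_self
    · have hn := ((summable_jacobiTheta₂_term_iff 0 τ).mpr τ.im_pos).norm
      refine hn.congr fun n => ?_
      simp [norm_jacobiTheta₂_term]
  have hval : ∀ n : ℤ, n ≠ 0 → ∫ x : ℝ in (0 : ℝ)..1, jacobiTheta₂_term n x τ = 0 := by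
    intro n hn
    have hc : (2 * Real.pi * Complex.I * n : ℂ) ≠ 0 := by
      simp [hn, Real.pi_ne_zero]
    have e : ∀ x : ℝ, jacobiTheta₂_term n x τ =
        Complex.exp (Real.pi * Complex.I * n ^ 2 * τ) *
          Complex.exp (2 * Real.pi * Complex.I * n * x) := by
      intro x
      rw [jacobiTheta₂_term, ← Complex.exp_add]
      congr 1
      ring
    simp only [e]
    rw [intervalIntegral.integral_const_mul, integral_exp_mul_complex hc]
    have e1 : Complex.exp (2 * Real.pi * Complex.I * n * (1 : ℝ)) = 1 := by
      rw [Complex.exp_eq_one_iff]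
      exact ⟨n, by push_cast; ring⟩
    rw [e1]
    simp
  have h1 := hsum.unique (hasSum_single 0 hval)
  have h2 : ∀ x : ℝ, ∑' n : ℤ, jacobiTheta₂_term n x τ = 0 := fun x => h0 x
  simp only [h2] at h1
  simp [jacobiTheta₂_term] at h1

theorem exists_oddTheta_ne_zero (τ : UpperHalfPlane) : ∃ z : ℂ, oddTheta τ z ≠ 0 := by
  obtain ⟨z, hz⟩ := exists_jacobiTheta₂_ne_zero τ
  refine ⟨z - τ * (1 / 2 : ℝ) - (1 / 2 : ℝ), ?_⟩
  rw [oddTheta, thetaChar_eq]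
  refine mul_ne_zero (Complex.exp_ne_zero _) ?_
  convert hz using 2
  ring

/-! ### The addition formula and its consequences -/

/-- The even theta function of doubled modulus and argument,
`∑ₙ exp(2πi n²τ + 4πi n z)` over the integers `n`. -/
noncomputable def doubleTheta (τ : UpperHalfPlane) (z : ℂ) : ℂ :=
  ∑' n : ℤ, Complex.exp (2 * Real.pi * Complex.I * (n : ℂ) ^ 2 * τ
    + 4 * Real.pi * Complex.I * n * z)

/-- The companion of `doubleTheta`: the same series over the half-integers. -/
noncomputable def doubleThetaHalf (τ : UpperHalfPlane) (z : ℂ) : ℂ :=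
  ∑' n : ℤ, Complex.exp (2 * Real.pi * Complex.I * ((n : ℂ) + 1 / 2) ^ 2 * τ
    + 4 * Real.pi * Complex.I * ((n : ℂ) + 1 / 2) * z)

theorem summable_thetaChar (a b : ℝ) (z : ℂ) (τ : UpperHalfPlane) :
    Summable fun n : ℤ => Complex.exp
      (Real.pi * Complex.I * ((n : ℂ) + a) ^ 2 * (τ : ℂ)
        + 2 * Real.pi * Complex.I * ((n : ℂ) + a) * (z + b)) := by
  refine (((summable_jacobiTheta₂_term_iff (z + τ * a + b) τ).mpr τ.im_pos).mul_left
    (Complex.exp (Real.pi * Complex.I * (a : ℂ) ^ 2 * (τ : ℂ)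
        + 2 * Real.pi * Complex.I * a * (z + b)))).congr fun n => ?_
  rw [jacobiTheta₂_term, ← Complex.exp_add]
  congr 1
  ring

theorem summable_doubleTheta (τ : UpperHalfPlane) (z : ℂ) :
    Summable fun n : ℤ => Complex.exp (2 * Real.pi * Complex.I * (n : ℂ) ^ 2 * τ
      + 4 * Real.pi * Complex.I * n * z) := by
  have h : 0 < (2 * (τ : ℂ)).im := by simpa using τ.im_pos
  refine ((summable_jacobiTheta₂_term_iff (2 * z) (2 * τ)).mpr h).congr fun n => ?_
  rw [jacobiTheta₂_term]
  congr 1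
  ring

theorem summable_doubleThetaHalf (τ : UpperHalfPlane) (z : ℂ) :
    Summable fun n : ℤ => Complex.exp (2 * Real.pi * Complex.I * ((n : ℂ) + 1 / 2) ^ 2 * τ
      + 4 * Real.pi * Complex.I * ((n : ℂ) + 1 / 2) * z) := by
  refine ((summable_doubleTheta τ (z + τ / 2)).mul_left
    (Complex.exp (Real.pi * Complex.I * τ / 2 + 2 * Real.pi * Complex.I * z))).congr
    fun n => ?_
  rw [← Complex.exp_add]
  congr 1
  ring

/-- A pair of integers `(n, m)` is determined by `n + m + 1` and `n - m`, which have opposite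
parities; the two summands record which of the two is even. -/
def intPairParityEquiv : (ℤ × ℤ) ⊕ (ℤ × ℤ) ≃ ℤ × ℤ where
  toFun := Sum.elim (fun p => (p.1 + p.2, p.1 - p.2 - 1)) (fun p => (p.1 + p.2, p.1 - p.2))
  invFun q := if Even (q.1 - q.2) then Sum.inr ((q.1 + q.2) / 2, (q.1 - q.2) / 2)
    else Sum.inl ((q.1 + q.2 + 1) / 2, (q.1 - q.2 - 1) / 2)
  left_inv := by
    rintro (⟨k, l⟩ | ⟨k, l⟩)
    · have h : ¬ Even (k + l - (k - l - 1)) := by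
        rw [Int.not_even_iff_odd]
        exact ⟨l, by ring⟩
      dsimp only [Sum.elim_inl]
      rw [if_neg h, Sum.inl.injEq, Prod.mk.injEq]
      omega
    · have h : Even (k + l - (k - l)) := ⟨l, by ring⟩
      dsimp only [Sum.elim_inr]
      rw [if_pos h, Sum.inr.injEq, Prod.mk.injEq]
      omega
  right_inv := by
    rintro ⟨n, m⟩
    by_cases h : Even (n - m)
    · simp only [if_pos h, Sum.elim_inr, Prod.mk.injEq]
      obtain ⟨r, hr⟩ := h
      omega
    · simp only [if_neg h, Sum.elim_inl, Prod.mk.injEq]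
      rw [Int.not_even_iff_odd] at h
      obtain ⟨r, hr⟩ := h
      omega

theorem hasSum_int_prod_mul {f g : ℤ → ℂ} (hf : Summable f) (hg : Summable g) :
    HasSum (fun p : ℤ × ℤ => f p.1 * g p.2) ((∑' n, f n) * ∑' n, g n) :=
  hf.hasSum.mul hg.hasSum (summable_mul_of_summable_norm hf.norm hg.norm)

/-- The addition formula: `θ₁(x + y) θ₁(x - y)` is a `2 × 2` determinant in `x` and `y`. In the
double series, the terms with `n + m + 1` even give the first product, the others the second. -/
theorem oddTheta_add_mul_sub (τ : UpperHalfPlane) (x y : ℂ) :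
    oddTheta τ (x + y) * oddTheta τ (x - y) =
      doubleTheta τ x * doubleThetaHalf τ y - doubleThetaHalf τ x * doubleTheta τ y := by
  have h1 := intPairParityEquiv.hasSum_iff.mpr (hasSum_int_prod_mul
    (summable_thetaChar (1 / 2) (1 / 2) (x + y) τ) (summable_thetaChar (1 / 2) (1 / 2) (x - y) τ))
  have h2 := hasSum_int_prod_mul (summable_doubleTheta τ x) (summable_doubleThetaHalf τ y)
  have h3 := (hasSum_int_prod_mul (summable_doubleThetaHalf τ x) (summable_doubleTheta τ y)).neg
  rw [sub_eq_add_neg (doubleTheta τ x * _)]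
  refine h1.unique (HasSum.sum ?_ ?_)
  · refine (congrArg (HasSum · _) (funext fun p => ?_)).mpr h2
    simp only [Function.comp_apply, intPairParityEquiv, Equiv.coe_fn_mk, Sum.elim_inl]
    rw [← Complex.exp_add, ← Complex.exp_add, Complex.exp_eq_exp_iff_exists_int]
    refine ⟨p.1, ?_⟩
    push_cast
    ring
  · refine (congrArg (HasSum · _) (funext fun p => ?_)).mpr h3
    simp only [Function.comp_apply, intPairParityEquiv, Equiv.coe_fn_mk, Sum.elim_inr]
    rw [← Complex.exp_add, ← Complex.exp_add, ← neg_one_mul, ← Complex.exp_pi_mul_I,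
      ← Complex.exp_add, Complex.exp_eq_exp_iff_exists_int]
    refine ⟨p.1, ?_⟩
    push_cast
    ring

/-- Weierstrass's three-term relation: the Plücker relation between `2 × 2` minors. -/
theorem oddTheta_three_term (τ : UpperHalfPlane) (a b c d : ℂ) :
    oddTheta τ (a + b) * oddTheta τ (a - b) * (oddTheta τ (c + d) * oddTheta τ (c - d)) =
      oddTheta τ (a + c) * oddTheta τ (a - c) * (oddTheta τ (b + d) * oddTheta τ (b - d))
      - oddTheta τ (a + d) * oddTheta τ (a - d) * (oddTheta τ (b + c) * oddTheta τ (b - c)) := by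
  simp only [oddTheta_add_mul_sub]
  ring

/-- The triplication formula. Divided by `θ₁(u)³ θ₁(3u)` it expresses
`3 θ₁'(u)/θ₁(u) - θ₁'(3u)/θ₁(3u)`. It is the derivative at `h = 0` of the three-term relation at
`(u + h, u, 2u, 0)`, where the left side has the factor `θ₁(h)`. -/
theorem deriv_oddTheta_zero_mul (τ : UpperHalfPlane) (u : ℂ) :
    deriv (oddTheta τ) 0 * oddTheta τ (2 * u) ^ 3 =
      3 * oddTheta τ (3 * u) * deriv (oddTheta τ) u * oddTheta τ u ^ 2
        - deriv (oddTheta τ) (3 * u) * oddTheta τ u ^ 3 := by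
  have hd : ∀ c : ℂ, HasDerivAt (fun h => oddTheta τ (c + h)) (deriv (oddTheta τ) c) 0 := by
    intro c
    have h := (differentiable_oddTheta τ (c + 0)).hasDerivAt.comp_const_add c 0
    rwa [add_zero] at h
  have hl := (((hd (2 * u)).mul (hd 0)).mul_const (oddTheta τ (2 * u) * oddTheta τ (2 * u)))
  have hr := (((hd (3 * u)).mul (hd (-u))).mul_const (oddTheta τ u * oddTheta τ u)).sub
    (((hd u).mul (hd u)).mul_const (oddTheta τ (3 * u) * oddTheta τ (-u)))
  have e := hl.unique (hr.congr_of_eventuallyEq (Filter.Eventually.of_forall fun h => ?_))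
  · simp only [add_zero, oddTheta_zero, oddTheta_neg, deriv_oddTheta_neg] at e
    linear_combination e
  · have h3 := oddTheta_three_term τ (u + h) u (2 * u) 0
    simp only [Pi.mul_apply, Pi.sub_apply]
    ring_nf at h3 ⊢
    linear_combination h3

/-! ### Zeros of the odd theta function -/

/-- Two entire functions with vanishing Wronskian are proportional. -/
theorem eq_const_mul_of_deriv_mul_eq {f g : ℂ → ℂ} (hf : Differentiable ℂ f)
    (hg : Differentiable ℂ g) {z₀ : ℂ} (hz₀ : g z₀ ≠ 0)
    (hfg : ∀ z, deriv f z * g z = f z * deriv g z) : ∃ C : ℂ, ∀ z, f z = C * g z := by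
  refine ⟨f z₀ / g z₀, fun z => ?_⟩
  obtain ⟨r, hr, hball⟩ := Metric.eventually_nhds_iff_ball.mp
    (hg.continuous.continuousAt.eventually_ne hz₀)
  have hconst : Set.EqOn (fun z => f z / g z) (fun _ => f z₀ / g z₀) (Metric.ball z₀ r) := by
    intro w hw
    refine Metric.isOpen_ball.is_const_of_deriv_eq_zero (𝕜 := ℂ) (f := fun z => f z / g z)
      (convex_ball z₀ r).isPreconnected (fun v hv => ?_) (fun v hv => ?_) hw
      (Metric.mem_ball_self hr)
    · exact ((hf v).div (hg v) (hball v hv)).differentiableWithinAt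
    · rw [deriv_fun_div (hf v) (hg v) (hball v hv), hfg, sub_self, zero_div]
      rfl
  have hloc : f =ᶠ[nhds z₀] fun z => f z₀ / g z₀ * g z := by
    filter_upwards [Metric.ball_mem_nhds z₀ hr] with w hw
    have h := hconst hw
    simp only at h
    rw [← h, div_mul_cancel₀ _ (hball w hw)]
  have ha : AnalyticOnNhd ℂ f Set.univ := fun w _ => hf.analyticAt w
  have hb : AnalyticOnNhd ℂ (fun z => f z₀ / g z₀ * g z) Set.univ :=
    fun w _ => (hg.const_mul _).analyticAt w
  exact congrFun (ha.eq_of_eventuallyEq hb hloc) z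

theorem exists_oddTheta_mul_add_ne_zero (τ : UpperHalfPlane) (x : ℂ) :
    ∃ q, oddTheta τ q ≠ 0 ∧ oddTheta τ (q + x) ≠ 0 := by
  by_contra! h
  have ha : AnalyticOnNhd ℂ (oddTheta τ) Set.univ :=
    fun w _ => (differentiable_oddTheta τ).analyticAt w
  have hb : AnalyticOnNhd ℂ (fun z => oddTheta τ (z + x)) Set.univ :=
    fun w _ => ((differentiable_oddTheta τ).comp (differentiable_id.add_const x)).analyticAt w
  obtain ⟨z, hz⟩ := exists_oddTheta_ne_zero τ
  rcases ha.eq_zero_or_eq_zero_of_mul_eq_zero hb (fun q _ => by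
      by_cases hq : oddTheta τ q = 0
      · simp [hq]
      · simp [h q hq]) isPreconnected_univ with h0 | h0
  · exact hz (h0 z trivial)
  · have := h0 (z - x) trivial
    rw [sub_add_cancel] at this
    exact hz this

/-- If `x` is a zero of `θ₁` then `θ₁(p + x) = C exp(α p) θ₁(p)`: by the three-term relation the
quotient `G(p) = θ₁(p + x) / θ₁(p)` has the property that `G(p) G(q)` depends only on `p + q`, so
its logarithmic derivative is constant. -/
theorem exists_oddTheta_add_eq {τ : UpperHalfPlane} {x : ℂ} (hx : oddTheta τ x = 0) :
    ∃ C α : ℂ, ∀ p, oddTheta τ (p + x) = C * (Complex.exp (α * p) * oddTheta τ p) := by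
  obtain ⟨q, hq, hqx⟩ := exists_oddTheta_mul_add_ne_zero τ x
  have hd := differentiable_oddTheta τ
  -- `G(p + h) G(q - h) = G(p) G(q)` with denominators cleared: the left side of the three-term
  -- relation has the factor `θ₁(a - b) = θ₁(x) = 0`.
  have key : ∀ p h : ℂ,
      oddTheta τ (p + h) * oddTheta τ (q - h) * (oddTheta τ (p + x) * oddTheta τ (q + x)) =
      oddTheta τ (p + x + h) * oddTheta τ (q + x - h) * (oddTheta τ p * oddTheta τ q) := by
    intro p h
    have h3 := oddTheta_three_term τ ((p + q) / 2 + x) ((p + q) / 2) ((p - q) / 2)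
      ((p - q) / 2 + h)
    have e : (p + q) / 2 + x - (p + q) / 2 = x := by ring
    rw [e, hx, mul_zero, zero_mul] at h3
    ring_nf at h3 ⊢
    linear_combination -h3
  have hadd : ∀ c : ℂ, HasDerivAt (fun h => oddTheta τ (c + h)) (deriv (oddTheta τ) c) 0 := by
    intro c
    have h := (hd (c + 0)).hasDerivAt.comp_const_add c 0
    rwa [add_zero] at h
  have hsub : ∀ c : ℂ, HasDerivAt (fun h => oddTheta τ (c - h)) (-deriv (oddTheta τ) c) 0 := by
    intro c
    have h := (hd (c - 0)).hasDerivAt.comp_const_sub c 0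
    rwa [sub_zero] at h
  -- The derivative of `key` at `h = 0`.
  have key' : ∀ p : ℂ,
      (deriv (oddTheta τ) p * oddTheta τ q - oddTheta τ p * deriv (oddTheta τ) q)
        * (oddTheta τ (p + x) * oddTheta τ (q + x)) =
      (deriv (oddTheta τ) (p + x) * oddTheta τ (q + x)
        - oddTheta τ (p + x) * deriv (oddTheta τ) (q + x)) * (oddTheta τ p * oddTheta τ q) := by
    intro p
    have hl := ((hadd p).mul (hsub q)).mul_const (oddTheta τ (p + x) * oddTheta τ (q + x))
    have hr := ((hadd (p + x)).mul (hsub (q + x))).mul_const (oddTheta τ p * oddTheta τ q)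
    have e := hl.unique (hr.congr_of_eventuallyEq
      (Filter.Eventually.of_forall fun h => key p h))
    simp only [add_zero, sub_zero] at e
    linear_combination e
  -- `α` is the logarithmic derivative of `G` at `q`.
  obtain ⟨α, hα⟩ : ∃ α, α * (oddTheta τ q * oddTheta τ (q + x)) =
      deriv (oddTheta τ) (q + x) * oddTheta τ q - oddTheta τ (q + x) * deriv (oddTheta τ) q :=
    ⟨_, div_mul_cancel₀ _ (mul_ne_zero hq hqx)⟩
  have hexp : ∀ p, HasDerivAt (fun p => Complex.exp (α * p)) (Complex.exp (α * p) * α) p :=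
    fun p => by simpa using ((hasDerivAt_id p).const_mul α).cexp
  have hE : ∀ p, HasDerivAt (fun p => Complex.exp (α * p) * oddTheta τ p)
      (Complex.exp (α * p) * α * oddTheta τ p + Complex.exp (α * p) * deriv (oddTheta τ) p) p :=
    fun p => (hexp p).mul (hd p).hasDerivAt
  obtain ⟨C, hC⟩ := eq_const_mul_of_deriv_mul_eq (f := fun p => oddTheta τ (p + x))
    (g := fun p => Complex.exp (α * p) * oddTheta τ p) (z₀ := q) (hd.comp (differentiable_id.add_const x))
    (fun p => (hE p).differentiableAt) (mul_ne_zero (Complex.exp_ne_zero _) hq) (fun p => by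
      rw [(hE p).deriv, deriv_comp_add_const]
      refine mul_right_cancel₀ (mul_ne_zero hq hqx) ?_
      linear_combination -Complex.exp (α * p) * key' p
        - Complex.exp (α * p) * oddTheta τ p * oddTheta τ (p + x) * hα)
  exact ⟨C, α, hC⟩

/-- The zeros of `θ₁` lie in the lattice `ℤτ + ℤ`: for a zero `x`, comparing the quasi-periods of
both sides of `θ₁(p + x) = C exp(α p) θ₁(p)` gives `exp α = 1` and `exp (α τ) = exp (-2πi x)`. -/
theorem exists_int_eq_of_oddTheta_eq_zero {τ : UpperHalfPlane} {x : ℂ} (hx : oddTheta τ x = 0) :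
    ∃ m n : ℤ, x = m * τ + n := by
  obtain ⟨C, α, h⟩ := exists_oddTheta_add_eq hx
  obtain ⟨p, -, hpx⟩ := exists_oddTheta_mul_add_ne_zero τ x
  have h0 := h p
  have h1 := h (p + 1)
  have ht := h (p + τ)
  rw [add_right_comm, oddTheta_add_one, oddTheta_add_one, mul_add, Complex.exp_add, mul_one] at h1
  rw [add_right_comm, oddTheta_add_tau, oddTheta_add_tau, mul_add α, Complex.exp_add] at ht
  have e1 : Complex.exp α = 1 := by
    refine mul_right_cancel₀ hpx ?_
    linear_combination Complex.exp α * h0 + h1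
  have et : Complex.exp (α * τ) = Complex.exp (-(2 * Real.pi * Complex.I * x)) := by
    have e : Complex.exp (-(Real.pi * Complex.I * τ + 2 * Real.pi * Complex.I * (p + x))) =
        Complex.exp (-(2 * Real.pi * Complex.I * x)) *
          Complex.exp (-(Real.pi * Complex.I * τ + 2 * Real.pi * Complex.I * p)) := by
      rw [← Complex.exp_add]
      congr 1
      ring
    rw [e] at ht
    refine mul_right_cancel₀ (mul_ne_zero (Complex.exp_ne_zero
      (-(Real.pi * Complex.I * τ + 2 * Real.pi * Complex.I * p))) hpx) ?_
    linear_combination ht + Complex.exp (α * τ) *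
      Complex.exp (-(Real.pi * Complex.I * τ + 2 * Real.pi * Complex.I * p)) * h0
  obtain ⟨n, hn⟩ := Complex.exp_eq_one_iff.mp e1
  obtain ⟨m, hm⟩ := Complex.exp_eq_exp_iff_exists_int.mp et
  refine ⟨-n, m, ?_⟩
  refine mul_left_cancel₀ Complex.two_pi_I_ne_zero ?_
  rw [hn] at hm
  push_cast
  linear_combination hm

theorem thetaConst_eq_mul_oddTheta (a b : ℝ) (τ : UpperHalfPlane) :
    thetaConst a b τ = Complex.exp (Real.pi * Complex.I * ((a : ℂ) - 1 / 2) ^ 2 * (τ : ℂ)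
        + 2 * Real.pi * Complex.I * ((a : ℂ) - 1 / 2) * b)
      * oddTheta τ (((a : ℂ) - 1 / 2) * τ + ((b : ℂ) - 1 / 2)) := by
  have h := thetaChar_add (a - 1 / 2) (b - 1 / 2) (1 / 2) (1 / 2) 0 τ
  rw [sub_add_cancel, sub_add_cancel] at h
  rw [thetaConst, h, oddTheta]
  push_cast
  congr 1
  · congr 1
    ring
  · congr 1
    ring

/-- A theta constant vanishes only at the characteristics congruent to `[1/2; 1/2]`. -/
theorem exists_int_of_thetaConst_eq_zero {a b : ℝ} {τ : UpperHalfPlane}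
    (h : thetaConst a b τ = 0) : ∃ m n : ℤ, a = m + 1 / 2 ∧ b = n + 1 / 2 := by
  rw [thetaConst_eq_mul_oddTheta] at h
  obtain ⟨m, n, hmn⟩ := exists_int_eq_of_oddTheta_eq_zero
    ((mul_eq_zero.mp h).resolve_left (Complex.exp_ne_zero _))
  have him := congrArg Complex.im hmn
  have hre := congrArg Complex.re hmn
  norm_num at him hre
  have ha : a - 1 / 2 = m := him.resolve_right τ.im_pos.ne'
  rw [ha] at hre
  exact ⟨m, n, by linarith, by linarith⟩

/-! ### The triplication formula for theta constants -/

theorem thetaConst_add_int (a b : ℝ) (M N : ℤ) (τ : UpperHalfPlane) :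
    thetaConst (a + M) (b + N) τ =
      Complex.exp (2 * Real.pi * Complex.I * a * N) * thetaConst a b τ :=
  thetaChar_add_int a b M N 0 τ

theorem thetaDeriv_add_int (a b : ℝ) (M N : ℤ) (τ : UpperHalfPlane) :
    thetaDeriv (a + M) (b + N) τ =
      Complex.exp (2 * Real.pi * Complex.I * a * N) * thetaDeriv a b τ := by
  simp only [thetaDeriv, thetaChar_add_int]
  rw [deriv_const_mul _ (differentiable_thetaChar a b τ 0)]

theorem thetaDeriv_eq_mul_oddTheta (a b : ℝ) (τ : UpperHalfPlane) :
    thetaDeriv a b τ = Complex.exp (Real.pi * Complex.I * ((a : ℂ) - 1 / 2) ^ 2 * (τ : ℂ)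
        + 2 * Real.pi * Complex.I * ((a : ℂ) - 1 / 2) * b)
      * (2 * Real.pi * Complex.I * ((a : ℂ) - 1 / 2)
          * oddTheta τ (((a : ℂ) - 1 / 2) * τ + ((b : ℂ) - 1 / 2))
        + deriv (oddTheta τ) (((a : ℂ) - 1 / 2) * τ + ((b : ℂ) - 1 / 2))) := by
  have hfun : (fun z => thetaChar a b z τ) = fun z =>
      Complex.exp (2 * Real.pi * Complex.I * ((a : ℂ) - 1 / 2) * z +
        (Real.pi * Complex.I * ((a : ℂ) - 1 / 2) ^ 2 * (τ : ℂ)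
          + 2 * Real.pi * Complex.I * ((a : ℂ) - 1 / 2) * b))
      * oddTheta τ (z + (((a : ℂ) - 1 / 2) * τ + ((b : ℂ) - 1 / 2))) := by
    funext z
    have h := thetaChar_add (a - 1 / 2) (b - 1 / 2) (1 / 2) (1 / 2) z τ
    rw [sub_add_cancel, sub_add_cancel] at h
    rw [h, oddTheta]
    push_cast
    congr 1
    · congr 1
      ring
    · congr 1
      ring
  have h1 := (((hasDerivAt_id (0 : ℂ)).const_mul
    (2 * Real.pi * Complex.I * ((a : ℂ) - 1 / 2))).add_const
      (Real.pi * Complex.I * ((a : ℂ) - 1 / 2) ^ 2 * (τ : ℂ)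
          + 2 * Real.pi * Complex.I * ((a : ℂ) - 1 / 2) * b)).cexp
  have h2 := ((differentiable_oddTheta τ)
    (0 + (((a : ℂ) - 1 / 2) * τ + ((b : ℂ) - 1 / 2)))).hasDerivAt.comp_add_const 0 _
  rw [thetaDeriv, hfun]
  have h3 := (h1.mul h2).deriv
  simp only [id_eq, mul_zero, zero_add, mul_one] at h3
  refine Eq.trans h3 ?_
  ring

/-- The triplication formula of `θ₁` at `u = (a - 1/2)τ + (b - 1/2)`, in terms of theta constants
with characteristics. -/
theorem thetaDeriv_triplication (a b : ℝ) (τ : UpperHalfPlane) :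
    thetaDeriv (1 / 2) (1 / 2) τ * Complex.exp (12 * Real.pi * Complex.I * a)
        * thetaConst (3 / 2 - 2 * a) (3 / 2 - 2 * b) τ ^ 3 =
      thetaDeriv (3 * a - 1) (3 * b - 1) τ * thetaConst a b τ ^ 3
        - 3 * thetaConst (3 * a - 1) (3 * b - 1) τ * thetaDeriv a b τ
          * thetaConst a b τ ^ 2 := by
  have h := deriv_oddTheta_zero_mul τ (((a : ℂ) - 1 / 2) * τ + ((b : ℂ) - 1 / 2))
  have e2 : (((3 / 2 - 2 * a : ℝ) : ℂ) - 1 / 2) * τ + (((3 / 2 - 2 * b : ℝ) : ℂ) - 1 / 2)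
      = -(2 * (((a : ℂ) - 1 / 2) * τ + ((b : ℂ) - 1 / 2))) := by
    push_cast
    ring
  have e3 : (((3 * a - 1 : ℝ) : ℂ) - 1 / 2) * τ + (((3 * b - 1 : ℝ) : ℂ) - 1 / 2)
      = 3 * (((a : ℂ) - 1 / 2) * τ + ((b : ℂ) - 1 / 2)) := by
    push_cast
    ring
  rw [thetaConst_eq_mul_oddTheta (3 / 2 - 2 * a), thetaConst_eq_mul_oddTheta (3 * a - 1),
    thetaConst_eq_mul_oddTheta a, thetaDeriv_eq_mul_oddTheta (3 * a - 1),
    thetaDeriv_eq_mul_oddTheta a, e2, e3, oddTheta_neg]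
  rw [show thetaDeriv (1 / 2) (1 / 2) τ = deriv (oddTheta τ) 0 from rfl]
  -- Since `2² · 3 = 3² + 3 · 1²`, the quadratic exponents in `τ` balance; what remains of the
  -- linear ones is `exp (12πi a)`.
  have hE : Complex.exp (12 * Real.pi * Complex.I * a)
      * Complex.exp (Real.pi * Complex.I * (((3 / 2 - 2 * a : ℝ) : ℂ) - 1 / 2) ^ 2 * (τ : ℂ)
        + 2 * Real.pi * Complex.I * (((3 / 2 - 2 * a : ℝ) : ℂ) - 1 / 2)
          * (3 / 2 - 2 * b : ℝ)) ^ 3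
      = Complex.exp (Real.pi * Complex.I * (((3 * a - 1 : ℝ) : ℂ) - 1 / 2) ^ 2 * (τ : ℂ)
        + 2 * Real.pi * Complex.I * (((3 * a - 1 : ℝ) : ℂ) - 1 / 2) * (3 * b - 1 : ℝ))
      * Complex.exp (Real.pi * Complex.I * ((a : ℂ) - 1 / 2) ^ 2 * (τ : ℂ)
        + 2 * Real.pi * Complex.I * ((a : ℂ) - 1 / 2) * b) ^ 3 := by
    rw [← Complex.exp_nat_mul, ← Complex.exp_nat_mul, ← Complex.exp_add, ← Complex.exp_add,
      Complex.exp_eq_exp_iff_exists_int]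
    refine ⟨3, ?_⟩
    push_cast
    ring
  generalize Complex.exp (12 * Real.pi * Complex.I * a) = E at *
  generalize Complex.exp (Real.pi * Complex.I * (((3 / 2 - 2 * a : ℝ) : ℂ) - 1 / 2) ^ 2 * (τ : ℂ)
        + 2 * Real.pi * Complex.I * (((3 / 2 - 2 * a : ℝ) : ℂ) - 1 / 2)
          * (3 / 2 - 2 * b : ℝ)) = c₂ at *
  generalize Complex.exp (Real.pi * Complex.I * (((3 * a - 1 : ℝ) : ℂ) - 1 / 2) ^ 2 * (τ : ℂ)
        + 2 * Real.pi * Complex.I * (((3 * a - 1 : ℝ) : ℂ) - 1 / 2) * (3 * b - 1 : ℝ)) = c₃ at *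
  generalize Complex.exp (Real.pi * Complex.I * ((a : ℂ) - 1 / 2) ^ 2 * (τ : ℂ)
        + 2 * Real.pi * Complex.I * ((a : ℂ) - 1 / 2) * b) = c₁ at *
  generalize ((a : ℂ) - 1 / 2) * τ + ((b : ℂ) - 1 / 2) = u at *
  push_cast
  linear_combination -(c₃ * c₁ ^ 3) * h
    - deriv (oddTheta τ) 0 * oddTheta τ (2 * u) ^ 3 * hE

theorem mulThree_eq_sub_floor (k : ℕ) (x : ℚ) :
    ((mulThree k x : ℚ) : ℝ) = 3 ^ k * x - (⌊3 ^ k * x⌋ : ℤ) := by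
  rw [mulThree, Int.fract]
  push_cast
  rfl

/-- One step of the recursion along the orbit of multiplication by `3`: divided by `θⱼ³ θⱼ₊₁`, it
expresses `3 θⱼ'/θⱼ - θⱼ₊₁'/θⱼ₊₁`, where the index `j` stands for the `j`-th characteristic. -/
theorem thetaDeriv_mulThree_step (ε' ε : ℚ) (j : ℕ) (τ : UpperHalfPlane) :
    thetaDeriv (1 / 2) (1 / 2) τ
        * Complex.exp
            (6 * Real.pi * Complex.I * (1 - (⌊3 ^ j * ε⌋ : ℂ)) * (mulThree j ε' : ℂ)
              - 2 * Real.pi * Complex.I * (⌊3 ^ (j + 1) * ε⌋ : ℂ) * (mulThree (j + 1) ε' : ℂ))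
        * thetaConst ((1 / 2 - 2 * 3 ^ j * ε' : ℚ) : ℝ)
            ((1 / 2 - 2 * 3 ^ j * ε : ℚ) : ℝ) τ ^ 3 =
      3 * thetaConst (mulThree (j + 1) ε') (mulThree (j + 1) ε) τ
          * thetaDeriv (mulThree j ε') (mulThree j ε) τ
          * thetaConst (mulThree j ε') (mulThree j ε) τ ^ 2
        - thetaDeriv (mulThree (j + 1) ε') (mulThree (j + 1) ε) τ
          * thetaConst (mulThree j ε') (mulThree j ε) τ ^ 3 := by
  have h := thetaDeriv_triplication (mulThree j ε') (mulThree j ε) τ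
  have hA := mulThree_eq_sub_floor j ε'
  have hB := mulThree_eq_sub_floor j ε
  have hA1 := mulThree_eq_sub_floor (j + 1) ε'
  have hB1 := mulThree_eq_sub_floor (j + 1) ε
  set F := ⌊3 ^ j * ε⌋
  set F1 := ⌊3 ^ (j + 1) * ε⌋
  set P := ⌊3 ^ j * ε'⌋
  set P1 := ⌊3 ^ (j + 1) * ε'⌋
  set X : ℝ := ((1 / 2 - 2 * 3 ^ j * ε' : ℚ) : ℝ) with hX
  set Y : ℝ := ((1 / 2 - 2 * 3 ^ j * ε : ℚ) : ℝ) with hY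
  push_cast at hX hY
  -- The characteristics of the triplication formula agree with those of the claim up to integers.
  have e1 : (3 / 2 - 2 * (mulThree j ε' : ℝ)) = X + (1 + 2 * P : ℤ) := by
    push_cast
    rw [hA, hX]
    ring
  have e2 : (3 / 2 - 2 * (mulThree j ε : ℝ)) = Y + (1 + 2 * F : ℤ) := by
    push_cast
    rw [hB, hY]
    ring
  have e3 : (3 * (mulThree j ε' : ℝ) - 1) = mulThree (j + 1) ε' + (P1 - 3 * P - 1 : ℤ) := by
    push_cast
    rw [hA, hA1]
    ring
  have e4 : (3 * (mulThree j ε : ℝ) - 1) = mulThree (j + 1) ε + (F1 - 3 * F - 1 : ℤ) := by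
    push_cast
    rw [hB, hB1]
    ring
  rw [e1, e2, e3, e4, thetaConst_add_int, thetaConst_add_int, thetaDeriv_add_int] at h
  have hXc : (X : ℂ) = 1 / 2 - 2 * (mulThree j ε' : ℂ) - 2 * P := by
    have e : X = 1 / 2 - 2 * (mulThree j ε' : ℝ) - 2 * P := by
      rw [hA, hX]
      ring
    rw [e]
    push_cast
    rfl
  have hA1c : (mulThree (j + 1) ε' : ℂ) = 3 * (mulThree j ε' : ℂ) + 3 * P - P1 := by
    have e : (mulThree (j + 1) ε' : ℝ) = 3 * (mulThree j ε' : ℝ) + 3 * P - P1 := by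
      rw [hA, hA1]
      ring
    exact_mod_cast congrArg ((↑) : ℝ → ℂ) e
  have hE : Complex.exp (12 * Real.pi * Complex.I * ((mulThree j ε' : ℝ) : ℂ))
      * Complex.exp (2 * Real.pi * Complex.I * X * (1 + 2 * F : ℤ)) ^ 3
      = -(Complex.exp (2 * Real.pi * Complex.I * ((mulThree (j + 1) ε' : ℝ) : ℂ)
          * (F1 - 3 * F - 1 : ℤ))
        * Complex.exp (6 * Real.pi * Complex.I * (1 - (F : ℂ)) * (mulThree j ε' : ℂ)
              - 2 * Real.pi * Complex.I * (F1 : ℂ) * (mulThree (j + 1) ε' : ℂ))) := by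
    rw [← neg_one_mul, ← Complex.exp_pi_mul_I, ← Complex.exp_nat_mul, ← Complex.exp_add,
      ← Complex.exp_add, ← Complex.exp_add, Complex.exp_eq_exp_iff_exists_int]
    refine ⟨1 + 3 * F - 6 * P - 12 * P * F + 3 * P * (3 * F + 1) - P1 * (3 * F + 1), ?_⟩
    simp only [Complex.ofReal_ratCast, hXc, hA1c]
    push_cast
    ring
  refine mul_left_cancel₀ (Complex.exp_ne_zero
    (2 * Real.pi * Complex.I * ((mulThree (j + 1) ε' : ℝ) : ℂ) * (F1 - 3 * F - 1 : ℤ))) ?_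
  linear_combination -h + thetaDeriv (1 / 2) (1 / 2) τ * thetaConst X Y τ ^ 3 * hE

/-! ### Periods of multiplication by three -/

theorem exists_mulThree_period {d : ℕ} (hd : Nat.Coprime 3 d) :
    ∃ t : ℕ, 0 < t ∧ ∀ x : ℚ, x.den ∣ d → ∀ k, mulThree (k + t) x = mulThree k x := by
  have hd0 : d ≠ 0 := by
    rintro rfl
    norm_num at hd
  refine ⟨d.totient, Nat.totient_pos.mpr (Nat.pos_of_ne_zero hd0), fun x hx k => ?_⟩
  have h := (Nat.modEq_iff_dvd.mp ((Nat.ModEq.pow_totient hd).symm.of_dvd hx))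
  obtain ⟨q, hq⟩ := h
  rw [mulThree, mulThree, Int.fract_eq_fract]
  refine ⟨3 ^ k * q * x.num, ?_⟩
  have hq' : (3 : ℚ) ^ d.totient - 1 = x.den * q := by
    exact_mod_cast hq
  have hx' : x * x.den = x.num := Rat.mul_den_eq_num x
  push_cast
  rw [pow_add]
  linear_combination 3 ^ k * x * hq' + 3 ^ k * q * hx'

theorem mulThree_mul_period {t : ℕ} {x : ℚ} (h : ∀ k, mulThree (k + t) x = mulThree k x) (n : ℕ) :
    mulThree (n * t) x = mulThree 0 x := by
  induction n with
  | zero => rw [zero_mul]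
  | succ n ih => rw [add_mul, one_mul, h, ih]

theorem mulThree_add_eq_half {k : ℕ} {x : ℚ} (h : mulThree k x = 1 / 2) (n : ℕ) :
    mulThree (k + n) x = 1 / 2 := by
  induction n with
  | zero => exact h
  | succ n ih =>
    rw [← add_assoc, mulThree_succ, ih, mulThree, Int.fract_eq_iff]
    exact ⟨by norm_num, by norm_num, 1, by norm_num⟩

/-- On a periodic orbit the fixed point `1/2` cannot be entered from outside. -/
theorem mulThree_zero_eq_half {t k : ℕ} {x : ℚ} (ht : 0 < t)
    (h : ∀ k, mulThree (k + t) x = mulThree k x) (hk : mulThree k x = 1 / 2) :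
    mulThree 0 x = 1 / 2 := by
  rw [← mulThree_mul_period h k]
  obtain ⟨n, hn⟩ := Nat.exists_eq_add_of_le (Nat.le_mul_of_pos_right k ht)
  rw [hn]
  exact mulThree_add_eq_half hk n

theorem mulThree_eq_half_of_eq_int_add {k : ℕ} {x : ℚ} {m : ℤ}
    (h : ((mulThree k x : ℚ) : ℝ) = m + 1 / 2) : mulThree k x = 1 / 2 := by
  have h' : mulThree k x = m + 1 / 2 := by
    have : ((mulThree k x : ℚ) : ℝ) = ((m + 1 / 2 : ℚ) : ℝ) := by
      push_cast
      exact h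
    exact_mod_cast this
  have h0 : 0 ≤ mulThree k x := Int.fract_nonneg _
  have h1 : mulThree k x < 1 := Int.fract_lt_one _
  have hm0 : (-1 : ℚ) < m := by linarith
  have hm1 : (m : ℚ) < 1 := by linarith
  have : m = 0 := by
    have h2 : -1 < m := by exact_mod_cast hm0
    have h3 : m < 1 := by exact_mod_cast hm1
    omega
  rw [h', this]
  norm_num

/-- For the period `1` the cubed factors vanish: their characteristics are congruent to
`[1/2; 1/2]`. -/
theorem thetaConst_eq_zero_of_period_one {ε' ε : ℚ} (h : IsThreePeriod 1 ε' ε) (j : ℕ)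
    (τ : UpperHalfPlane) :
    thetaConst ((1 / 2 - 2 * 3 ^ j * ε' : ℚ) : ℝ) ((1 / 2 - 2 * 3 ^ j * ε : ℚ) : ℝ) τ = 0 := by
  have hint : ∀ x : ℚ, mulThree (j + 1) x = mulThree j x →
      ∃ m : ℤ, ((1 / 2 - 2 * 3 ^ j * x : ℚ) : ℝ) = 1 / 2 + m := by
    intro x hx
    rw [mulThree, mulThree, Int.fract_eq_fract] at hx
    obtain ⟨z, hz⟩ := hx
    refine ⟨-z, ?_⟩
    have e : (1 / 2 - 2 * 3 ^ j * x : ℚ) = 1 / 2 + (-z : ℤ) := by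
      push_cast
      rw [← hz, pow_succ]
      ring
    rw [e]
    push_cast
    rfl
  obtain ⟨m, hm⟩ := hint ε' (h.2 j).1
  obtain ⟨n, hn⟩ := hint ε (h.2 j).2
  rw [hm, hn, thetaConst_add_int]
  exact mul_eq_zero_of_right _ (oddTheta_zero τ)

/-! ### Solving the periodic recursion -/

theorem prod_Ico_add_period {M : Type*} [CommMonoid M] {f : ℕ → M} {t : ℕ}
    (hf : ∀ k, f (k + t) = f k) (k : ℕ) :
    ∏ i ∈ Finset.Ico k (k + t), f i = ∏ i ∈ Finset.range t, f i := by
  induction k with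
  | zero => rw [zero_add, Finset.range_eq_Ico]
  | succ k ih =>
    rcases Nat.eq_zero_or_pos t with rfl | ht
    · simp
    rw [← ih, Finset.prod_eq_prod_Ico_succ_bot (show k < k + t by omega), add_right_comm,
      Finset.prod_Ico_succ_top (show k + 1 ≤ k + t by omega), hf, mul_comm]

/-- Over a window of one period `t ≥ 2`, the residues `j` and `j + 1` each occur once. -/
theorem mul_mul_prod_Ico_filter_modEq {M : Type*} [CommMonoid M] {f : ℕ → M} {t : ℕ}
    (hf : ∀ k, f (k + t) = f k) (ht : 2 ≤ t) (k j : ℕ) :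
    f j * f (j + 1) *
        ∏ l ∈ Finset.Ico k (k + t) with ¬ l ≡ j [MOD t] ∧ ¬ l ≡ j + 1 [MOD t], f l =
      ∏ i ∈ Finset.range t, f i := by
  have hmod : ∀ l m : ℕ, l + t ≡ m [MOD t] ↔ l ≡ m [MOD t] := fun l m => by
    simp [Nat.ModEq]
  -- Being periodic, the product may be taken over the window that starts at `j`.
  rw [Finset.prod_filter, prod_Ico_add_period (fun l => by simp only [hmod, hf]),
    ← prod_Ico_add_period (k := j) (fun l => by simp only [hmod, hf]),
    ← prod_Ico_add_period hf j]
  rw [Finset.prod_eq_prod_Ico_succ_bot (show j < j + t by omega),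
    Finset.prod_eq_prod_Ico_succ_bot (show j + 1 < j + t by omega),
    Finset.prod_eq_prod_Ico_succ_bot (show j < j + t by omega),
    Finset.prod_eq_prod_Ico_succ_bot (show j + 1 < j + t by omega)]
  rw [if_neg (fun h => h.1 rfl), if_neg (fun h => h.2 rfl), one_mul, one_mul, mul_assoc]
  congr 2
  refine Finset.prod_congr rfl fun l hl => ?_
  rw [Finset.mem_Ico] at hl
  have hne : ∀ m, m ≤ l → l < m + t → l ≡ m [MOD t] → l = m := fun m h1 h2 h3 => by
    have h4 := (Nat.modEq_iff_dvd' h1).mp h3.symm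
    have h5 := Nat.eq_zero_of_dvd_of_lt h4 (by omega)
    omega
  rw [if_pos]
  refine ⟨fun h => ?_, fun h => ?_⟩
  · have := hne j (by omega) (by omega) h
    omega
  · have := hne (j + 1) (by omega) (by omega) h
    omega

theorem sum_Ico_three_pow_mul (L : ℕ → ℂ) (k n : ℕ) :
    ∑ j ∈ Finset.Ico k (k + n), (3 : ℂ) ^ (n - 1 + k - j) * (3 * L j - L (j + 1)) =
      3 ^ n * L k - L (k + n) := by
  induction n with
  | zero => simp
  | succ n ih =>
    rw [← add_assoc, Finset.sum_Ico_succ_top (show k ≤ k + n by omega)]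
    have h : ∑ j ∈ Finset.Ico k (k + n), (3 : ℂ) ^ (n + 1 - 1 + k - j) * (3 * L j - L (j + 1)) =
        3 * ∑ j ∈ Finset.Ico k (k + n), (3 : ℂ) ^ (n - 1 + k - j) * (3 * L j - L (j + 1)) := by
      rw [Finset.mul_sum]
      refine Finset.sum_congr rfl fun j hj => ?_
      rw [Finset.mem_Ico] at hj
      rw [show n + 1 - 1 + k - j = n - 1 + k - j + 1 by omega, pow_succ]
      ring
    rw [h, ih, show n + 1 - 1 + k - (k + n) = 0 by omega]
    ring

/-- The solution of the recursion `3 dⱼ/cⱼ - dⱼ₊₁/cⱼ₊₁ = wⱼ/(cⱼ³ cⱼ₊₁)` for periodic sequences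
`c` and `d`. When `t = 1`, the residues `j` and `j + 1` coincide and the product does not supply
the factor `cⱼ₊₁⁻¹`; there the formula holds because `w` vanishes. -/
theorem eq_sum_of_periodic_recursion {c d w : ℕ → ℂ} {t : ℕ} (ht : 0 < t)
    (hc : ∀ k, c (k + t) = c k) (hd : ∀ k, d (k + t) = d k) (hc0 : ∀ k, c k ≠ 0)
    (hw : ∀ j, w j = 3 * c (j + 1) * d j * c j ^ 2 - d (j + 1) * c j ^ 3)
    (hw1 : t = 1 → ∀ j, w j = 0) (k : ℕ) :
    d k = ((3 ^ t - 1) * ∏ i ∈ Finset.range t, c i)⁻¹ * c k *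
      ∑ j ∈ Finset.Ico k (k + t), 3 ^ (t - 1 + k - j) * w j * c j ^ (-2 : ℤ) *
        ∏ l ∈ Finset.Ico k (k + t) with ¬ l ≡ j [MOD t] ∧ ¬ l ≡ j + 1 [MOD t], c l := by
  have hprod : ∏ i ∈ Finset.range t, c i ≠ 0 := Finset.prod_ne_zero_iff.mpr fun i _ => hc0 i
  have h3 : (3 : ℂ) ^ t - 1 ≠ 0 := by
    rw [sub_ne_zero]
    have : (3 : ℕ) ^ t ≠ 1 := (Nat.one_lt_pow ht.ne' (by norm_num)).ne'
    exact_mod_cast this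
  have hterm : ∀ j, w j * c j ^ (-2 : ℤ) *
      ∏ l ∈ Finset.Ico k (k + t) with ¬ l ≡ j [MOD t] ∧ ¬ l ≡ j + 1 [MOD t], c l =
      (∏ i ∈ Finset.range t, c i) * (3 * (d j / c j) - d (j + 1) / c (j + 1)) := by
    intro j
    have hj := hc0 j
    have hj1 := hc0 (j + 1)
    have hL : 3 * (d j / c j) - d (j + 1) / c (j + 1) = w j / (c j ^ 3 * c (j + 1)) := by
      rw [hw]
      field_simp
    rw [hL]
    rcases Nat.lt_or_ge t 2 with h2 | h2
    · rw [hw1 (by omega) j]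
      simp
    · rw [← mul_mul_prod_Ico_filter_modEq hc h2 k j]
      generalize ∏ l ∈ Finset.Ico k (k + t) with ¬ l ≡ j [MOD t] ∧ ¬ l ≡ j + 1 [MOD t], c l = Q
      rw [zpow_neg, zpow_ofNat]
      field_simp
  have hsum : ∑ j ∈ Finset.Ico k (k + t), 3 ^ (t - 1 + k - j) * w j * c j ^ (-2 : ℤ) *
        ∏ l ∈ Finset.Ico k (k + t) with ¬ l ≡ j [MOD t] ∧ ¬ l ≡ j + 1 [MOD t], c l =
      (∏ i ∈ Finset.range t, c i) * ((3 ^ t - 1) * (d k / c k)) := by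
    have h := sum_Ico_three_pow_mul (fun j => d j / c j) k t
    simp only [hc, hd] at h
    rw [sub_mul, one_mul, ← h, Finset.mul_sum]
    refine Finset.sum_congr rfl fun j _ => ?_
    linear_combination 3 ^ (t - 1 + k - j) * hterm j
  have hk := hc0 k
  rw [hsum]
  field_simp

/-! ### Theta derivatives along a periodic orbit -/

theorem mainTheorem2 (ε' ε : ℚ) :
    (¬ 3 ∣ ε'.den → ¬ 3 ∣ ε.den → ∃ t : ℕ, IsThreePeriod t ε' ε) ∧
    ∀ t : ℕ, IsThreePeriod t ε' ε →
      ¬ (mulThree 0 ε' = 1 / 2 ∧ mulThree 0 ε = 1 / 2) →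
      ∀ τ : UpperHalfPlane,
        (∀ k : ℕ, thetaConst (mulThree k ε') (mulThree k ε) τ ≠ 0) ∧
        ∀ k : ℕ, k < t →
          thetaDeriv (mulThree k ε') (mulThree k ε) τ =
            (((3 : ℂ) ^ t - 1) *
                ∏ i ∈ Finset.range t, thetaConst (mulThree i ε') (mulThree i ε) τ)⁻¹
              * thetaDeriv (1 / 2) (1 / 2) τ
              * thetaConst (mulThree k ε') (mulThree k ε) τ
              * ∑ j ∈ Finset.Ico k (k + t),
                  (3 : ℂ) ^ (t - 1 + k - j)
                  * Complex.exp
                      (6 * Real.pi * Complex.I * (1 - (⌊3 ^ j * ε⌋ : ℂ)) * (mulThree j ε' : ℂ)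
                        - 2 * Real.pi * Complex.I * (⌊3 ^ (j + 1) * ε⌋ : ℂ)
                          * (mulThree (j + 1) ε' : ℂ))
                  * thetaConst ((1 / 2 - 2 * 3 ^ j * ε' : ℚ) : ℝ)
                      ((1 / 2 - 2 * 3 ^ j * ε : ℚ) : ℝ) τ ^ 3
                  * thetaConst (mulThree j ε') (mulThree j ε) τ ^ (-2 : ℤ)
                  * ∏ l ∈ Finset.Ico k (k + t) with
                      ¬ l ≡ j [MOD t] ∧ ¬ l ≡ j + 1 [MOD t],
                      thetaConst (mulThree l ε') (mulThree l ε) τ := by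
  refine ⟨fun h1 h2 => ?_, fun t ht hne τ => ?_⟩
  · have hcop : Nat.Coprime 3 (ε'.den * ε.den) := Nat.Coprime.mul_right
      ((Nat.Prime.coprime_iff_not_dvd Nat.prime_three).mpr h1)
      ((Nat.Prime.coprime_iff_not_dvd Nat.prime_three).mpr h2)
    obtain ⟨t, ht, h⟩ := exists_mulThree_period hcop
    exact ⟨t, ht, fun k => ⟨h ε' (dvd_mul_right _ _) k, h ε (dvd_mul_left _ _) k⟩⟩
  · have hc0 : ∀ k : ℕ, thetaConst (mulThree k ε') (mulThree k ε) τ ≠ 0 := by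
      intro k hk
      obtain ⟨m, n, hm, hn⟩ := exists_int_of_thetaConst_eq_zero hk
      exact hne
        ⟨mulThree_zero_eq_half ht.1 (fun k => (ht.2 k).1) (mulThree_eq_half_of_eq_int_add hm),
          mulThree_zero_eq_half ht.1 (fun k => (ht.2 k).2) (mulThree_eq_half_of_eq_int_add hn)⟩
    refine ⟨hc0, fun k _ => ?_⟩
    have h := eq_sum_of_periodic_recursion
      (c := fun k => thetaConst (mulThree k ε') (mulThree k ε) τ)
      (d := fun k => thetaDeriv (mulThree k ε') (mulThree k ε) τ) ht.1
      (fun k => by simp only [(ht.2 k).1, (ht.2 k).2])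
      (fun k => by simp only [(ht.2 k).1, (ht.2 k).2]) hc0
      (fun j => thetaDeriv_mulThree_step ε' ε j τ)
      (fun h1 j => by
        subst h1
        rw [thetaConst_eq_zero_of_period_one ht, zero_pow three_ne_zero, mul_zero]) k
    refine h.trans ?_
    rw [mul_right_comm _ (thetaDeriv (1 / 2) (1 / 2) τ) _,
      mul_assoc _ (thetaDeriv (1 / 2) (1 / 2) τ) _,
      Finset.mul_sum _ _ (thetaDeriv (1 / 2) (1 / 2) τ)]
    congr 1
    refine Finset.sum_congr rfl fun j _ => ?_
    ring
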